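/- Let $q \in (0,1)$ and $\theta = \min(q, 1-q)$. Let $\ell_q(v, p) = (1-q)\,((v-p)_+)^2 + q\,((p-v)_+)^2$ be the expectile loss, and for a distribution $D$ on $[0,1]$ let $\mathrm{EVaR}_q(D) = \arg\min_{p \in [0,1]} \mathbb{E}_{v \sim D}[\ell_q(v,p)]$. Let $\mathcal{A}$ be a finite nonempty action set, $\mathcal{X}$ a context space, and $\mathcal{F} \subseteq (\mathcal{X} \times \mathcal{A} \to [0,1])$. Protocol. In each round $t = 1, \dots, T$ an adaptive environment chooses, from the past (and possibly private information and randomness of its own), a context $x_t \in \mathcal{X}$ and a distribution $\mathbb{P}_{l_t}$ of a loss function $l_t : \mathcal{A} \to [0,1]$. The learner plays an action $a_t$ and observes $l_t(a_t)$, where, given what is known at that point, $l_t \sim \mathbb{P}_{l_t}$ is independent of $a_t$. Realizability: almost surely, some $f^* \in \mathcal{F}$ satisfies $f^*(x_t, a) = \mathrm{EVaR}_q((l_t)_a)$ for all $a \in \mathcal{A}$ and $t \le T$, where $\mathrm{EVaR}_q((l_t)_a)$ is $\mathrm{EVaR}_q$ of the law of $l_t(a)$ under $\mathbb{P}_{l_t}$.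 Oracle. An online regression oracle outputs, given $(x_s, a_s, l_s(a_s))_{s<t}$ and $x_t$, predictions $\hat f_t(x_t, \cdot) : \mathcal{A} \to [0,1]$. It is assumed that, for every sequence $(x_t, a_t, l_t)_{t \le T}$ and every $f \in \mathcal{F}$, $$\sum_{t=1}^T \Big( \ell_q\big(l_t(a_t), \hat f_t(x_t,a_t)\big) - \ell_q\big(l_t(a_t), f(x_t,a_t)\big) \Big) \le \mathrm{Reg}_{\mathrm{EVaR}_q}(T),$$ with a constant $\mathrm{Reg}_{\mathrm{EVaR}_q}(T) > 0$ that does not depend on the data. Algorithm (SquareCB with expectile loss and learning rate $\gamma > 0$). In round $t$, let $\hat a_t$ be an exact minimizer of $\hat f_t(x_t, \cdot)$ and draw $a_t$ from the distribution $\mathrm{AL}_t$ on $\mathcal{A}$ given by $$\mathrm{AL}_t(a) = \frac{1}{|\mathcal{A}| + 4\theta\gamma\,(\hat f_t(x_t,a) - \hat f_t(x_t,\hat a_t))} \quad (a \ne \hat a_t), \qquad \mathrm{AL}_t(\hat a_t) = 1 - \sum_{a \ne \hat a_t} \mathrm{AL}_t(a).$$ Theorem. There is a universal constant $C > 0$ such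 that the following holds. For all $|\mathcal{A}|$, $T$, $q$ and all values $\mathrm{Reg}_{\mathrm{EVaR}_q}(T) > 0$ there is a learning rate $\gamma > 0$, depending only on these four quantities, with which the algorithm guarantees, against every such environment and with every such oracle, that $$\mathbb{E}\big[\mathrm{Reg}_{CB}(T)\big] \le \frac{C}{\theta} \sqrt{|\mathcal{A}|\, T\, \mathrm{Reg}_{\mathrm{EVaR}_q}(T)}, \qquad \mathrm{Reg}_{CB}(T) = \sum_{t=1}^T \sum_{a \in \mathcal{A}} \mathrm{AL}_t(a) \Big( \mathrm{EVaR}_q\big((l_t)_a\big) - \min_{b \in \mathcal{A}} \mathrm{EVaR}_q\big((l_t)_b\big) \Big).$$ -/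

import Mathlib

open MeasureTheory ProbabilityTheory Finset
open scoped unitInterval

noncomputable section

namespace ExpectileBandit

/-! ### Expectile loss and the risk measure -/

/-- The expectile loss of the prediction `p` when the realized value is `v`:
`(1 - q) ((v - p)_+)^2 + q ((p - v)_+)^2`. -/
def expectileLoss (q v p : ℝ) : ℝ :=
  (1 - q) * (max (v - p) 0) ^ 2 + q * (max (p - v) 0) ^ 2

/-- The minimizers over `[0, 1]` of the expected expectile loss under the distribution `D`. -/
def expectiles (q : ℝ) (D : Measure ℝ) : Set ℝ :=
  {p | p ∈ Set.Icc (0 : ℝ) 1 ∧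
    IsMinOn (fun p' : ℝ => ∫ v, expectileLoss q v p' ∂D) (Set.Icc (0 : ℝ) 1) p}

/-- `EVaR_q(D)`, the argmin over `[0, 1]` of the expected expectile loss. For `0 < q < 1` and a
probability distribution `D` on `[0, 1]`, the set `expectiles q D` has exactly one element (the
expected loss is continuous and strongly convex), and `evar q D` is that element. -/
def evar (q : ℝ) (D : Measure ℝ) : ℝ := sInf (expectiles q D)

/-! ### The online regression oracle -/

/-- An online regression oracle. Before round `t` it has seen the examples
`(x_s, a_s, l_s(a_s))`, `s < t`; given these and the context `x_t`, it outputs the predictions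
`a ↦ f̂_t(x_t, a)` in `[0, 1]`. -/
abbrev RegOracle (X A : Type*) : Type _ :=
  (t : ℕ) → (Fin t → X × A × I) → X → A → I

/-- The examples of the rounds before `t`. -/
def examples {X A : Type*} (x : ℕ → X) (a : ℕ → A) (y : ℕ → I) (t : ℕ) : Fin t → X × A × I :=
  fun s => (x s, a s, y s)

/-- The oracle's predictions depend measurably on the examples seen and on the context. -/
def RegOracle.IsMeasurable {X A : Type*} [MeasurableSpace X] [MeasurableSpace A]
    (oracle : RegOracle X A) : Prop :=
  ∀ (t : ℕ) (a : A), Measurable fun p : (Fin t → X × A × I) × X => oracle t p.1 p.2 a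

/-- The cumulative expectile loss of the oracle over `T` rounds exceeds that of any `f ∈ F` by at
most `R`, for every sequence of contexts, actions and realized losses. (The oracle's predictions
are functions of the past, so adaptively chosen sequences are included.) -/
def RegOracle.HasRegret {X A : Type*} (oracle : RegOracle X A) (q : ℝ) (F : Set (X → A → I))
    (T : ℕ) (R : ℝ) : Prop :=
  ∀ (x : ℕ → X) (a : ℕ → A) (y : ℕ → I), ∀ f ∈ F,
    ∑ t ∈ range T,
      (expectileLoss q (y t) (oracle t (examples x a y t) (x t) (a t))
        - expectileLoss q (y t) (f (x t) (a t))) ≤ R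

/-! ### The algorithm -/

/-- The inverse gap weighting distribution `AL(f̂, â)` with learning rate `γ`, where `f a` is the
prediction for action `a` and `θ = min(q, 1 - q)`. -/
def invGapWeight {A : Type*} [Fintype A] [DecidableEq A] (q γ : ℝ) (f : A → I) (ahat a : A) : ℝ :=
  if a = ahat then
    1 - ∑ b ∈ univ.erase ahat,
      1 / ((Fintype.card A : ℝ) + 4 * min q (1 - q) * γ * ((f b : ℝ) - (f ahat : ℝ)))
  else
    1 / ((Fintype.card A : ℝ) + 4 * min q (1 - q) * γ * ((f a : ℝ) - (f ahat : ℝ)))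

/-- The random variables of an interaction of the algorithm with an adaptive environment.
* `known t` is the information available in round `t` just before the action and the loss function
  are drawn. It may hold private information and randomness of the environment.
* `ctx t` is the context `x_t`, `lossLaw t` the distribution `ℙ_{l_t}` of the loss function that the
  environment has chosen, and `loss t` the loss function `l_t`.
* `greedy t` is the output `â_t` of the optimization oracle, and `act t` is the action `a_t`. -/
structure Interaction (X A Ω : Type*) [mΩ : MeasurableSpace Ω] where
  known : Filtration ℕ mΩ
  ctx : ℕ → Ω → X
  lossLaw : ℕ → Ω → Measure (A → I)
  loss : ℕ → Ω → A → I
  greedy : ℕ → Ω → A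
  act : ℕ → Ω → A

namespace Interaction

variable {X A Ω : Type*} [MeasurableSpace X] [MeasurableSpace Ω]

/-- The oracle's predictions `a ↦ f̂_t(x_t, a)` in round `t`. -/
def pred (E : Interaction X A Ω) (oracle : RegOracle X A) (t : ℕ) (ω : Ω) : A → I :=
  oracle t (examples (fun s => E.ctx s ω) (fun s => E.act s ω)
    (fun s => E.loss s ω (E.act s ω)) t) (E.ctx t ω)

/-- The risk `EVaR_q((l_t)_a)` of action `a` in round `t`: it is a function of the distribution of
`l_t(a)` chosen by the environment. -/
def risk (E : Interaction X A Ω) (q : ℝ) (t : ℕ) (ω : Ω) (a : A) : ℝ :=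
  evar q ((E.lossLaw t ω).map fun l : A → I => (l a : ℝ))

/-- The probability with which the algorithm plays action `a` in round `t`. -/
def prob [Fintype A] [DecidableEq A] (E : Interaction X A Ω) (oracle : RegOracle X A)
    (q γ : ℝ) (t : ℕ) (ω : Ω) (a : A) : ℝ :=
  invGapWeight q γ (E.pred oracle t ω) (E.greedy t ω) a

/-- During the first `T` rounds, the variables follow the protocol: the environment chooses the
context and the distribution of the loss function from what is known; `â_t` is an exact minimizer
of `f̂_t(x_t, ·)`; then, given what is known, `a_t` is drawn from `AL(f̂_t, â_t)` and, independently,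
`l_t` from the distribution chosen by the environment. -/
structure FollowsProtocol [Fintype A] [DecidableEq A] [MeasurableSpace A]
    (E : Interaction X A Ω) (P : Measure Ω) (oracle : RegOracle X A) (q γ : ℝ) (T : ℕ) :
    Prop where
  measurable_ctx : ∀ t < T, Measurable[E.known t] (E.ctx t)
  measurable_lossLaw : ∀ t < T, Measurable[E.known t] (E.lossLaw t)
  measurable_greedy : ∀ t < T, Measurable[E.known t] (E.greedy t)
  measurable_act : ∀ t < T, Measurable[E.known (t + 1)] (E.act t)
  measurable_loss : ∀ t < T, Measurable[E.known (t + 1)] (E.loss t)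
  isProbabilityMeasure_lossLaw : ∀ t < T, ∀ ω, IsProbabilityMeasure (E.lossLaw t ω)
  greedy_le : ∀ t < T, ∀ᵐ ω ∂P, ∀ a, E.pred oracle t ω (E.greedy t ω) ≤ E.pred oracle t ω a
  law_act_loss : ∀ t < T, ∀ S : Set Ω, MeasurableSet[E.known t] S →
    ∀ (a : A) (B : Set (A → I)), MeasurableSet B →
      P (S ∩ {ω | E.act t ω = a ∧ E.loss t ω ∈ B}) =
        ∫⁻ ω in S, ENNReal.ofReal (E.prob oracle q γ t ω a) * E.lossLaw t ω B ∂P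

/-- Realizability: almost surely, some `f ∈ F` gives the risk of every action in every context
encountered during the `T` rounds. -/
def Realizable (E : Interaction X A Ω) (P : Measure Ω) (q : ℝ) (F : Set (X → A → I))
    (T : ℕ) : Prop :=
  ∀ᵐ ω ∂P, ∃ f ∈ F, ∀ t < T, ∀ a, (f (E.ctx t ω) a : ℝ) = E.risk q t ω a

/-- The contextual bandit regret `Reg_CB(T)` along the trajectory `ω`: the sum over the rounds of
the expectation, over the algorithm's action distribution, of the excess of the risk of the action
over the smallest risk of an action. -/
def regCB [Fintype A] [DecidableEq A] (E : Interaction X A Ω) (oracle : RegOracle X A)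
    (q γ : ℝ) (T : ℕ) (ω : Ω) : ℝ :=
  ∑ t ∈ range T, ∑ a, E.prob oracle q γ t ω a * (E.risk q t ω a - ⨅ b, E.risk q t ω b)

end Interaction

end ExpectileBandit

end

open ExpectileBandit

namespace ExpectileBandit

/-! Write θ = min(q, 1-q). The expectile loss is strongly convex in the prediction, and the EVaR of
a law on [0,1] is the zero of its expected slope. Hence predicting p costs at least θ (p - EVaR)² in
expected excess loss (`mul_sq_sub_evar_le`). Given the past, the action and the loss function are
independent, so these excess losses can be averaged along the play. Under realizability the oracle's
regret then bounds θ times the expected squared error of the predictions, weighted by the action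
probabilities (`mul_sum_integral_sq_error_le`).

Inverse gap weighting with μ = 4θγ turns squared error into regret: a round costs at most 2n/μ plus
μ/2 times its weighted squared error (`sum_invGapWeight_mul_sub_le`), where n is the number of
actions. Summing over rounds gives nT/(2θγ) + 2γR (`integral_regCB_le`), and γ is chosen to balance
the two terms. -/

/-! ### Pointwise convexity of the expectile loss. -/

/-- Half the derivative of `p ↦ expectileLoss q v p`. -/
noncomputable def expectileSlope (q v p : ℝ) : ℝ :=
  q * max (p - v) 0 - (1 - q) * max (v - p) 0

lemma continuous_expectileLoss (q : ℝ) :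
    Continuous fun z : ℝ × ℝ => expectileLoss q z.1 z.2 := by
  unfold expectileLoss; fun_prop

lemma continuous_expectileSlope (q : ℝ) :
    Continuous fun z : ℝ × ℝ => expectileSlope q z.1 z.2 := by
  unfold expectileSlope; fun_prop

lemma expectileLoss_mem_Icc {q v p : ℝ} (hq : q ∈ Set.Icc (0 : ℝ) 1)
    (hv : v ∈ Set.Icc (0 : ℝ) 1) (hp : p ∈ Set.Icc (0 : ℝ) 1) :
    expectileLoss q v p ∈ Set.Icc (0 : ℝ) 1 := by
  obtain ⟨hq0, hq1⟩ := hq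
  obtain ⟨hv0, hv1⟩ := hv
  obtain ⟨hp0, hp1⟩ := hp
  unfold expectileLoss
  rcases le_total v p with h | h
  · rw [max_eq_right (by linarith : v - p ≤ 0), max_eq_left (by linarith : 0 ≤ p - v)]
    constructor
    · nlinarith [mul_nonneg hq0 (sq_nonneg (p - v))]
    · have : (p - v) ^ 2 ≤ 1 := by nlinarith
      nlinarith [mul_le_mul_of_nonneg_left this hq0]
  · rw [max_eq_right (by linarith : p - v ≤ 0), max_eq_left (by linarith : 0 ≤ v - p)]
    have hq' : 0 ≤ 1 - q := by linarith
    constructor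
    · nlinarith [mul_nonneg hq' (sq_nonneg (v - p))]
    · have : (v - p) ^ 2 ≤ 1 := by nlinarith
      nlinarith [mul_le_mul_of_nonneg_left this hq']

lemma abs_expectileLoss_le {q v p M : ℝ} (hq : q ∈ Set.Icc (0 : ℝ) 1)
    (h : |p - v| ≤ M) : |expectileLoss q v p| ≤ M ^ 2 := by
  obtain ⟨hq0, hq1⟩ := hq
  have hM : (p - v) ^ 2 ≤ M ^ 2 := sq_le_sq' (abs_le.1 h).1 (abs_le.1 h).2
  have h1 : (max (v - p) 0) ^ 2 ≤ M ^ 2 := by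
    rcases le_total (v - p) 0 with h | h
    · rw [max_eq_right h]; nlinarith [sq_nonneg M]
    · rw [max_eq_left h]; nlinarith
  have h2 : (max (p - v) 0) ^ 2 ≤ M ^ 2 := by
    rcases le_total (p - v) 0 with h | h
    · rw [max_eq_right h]; nlinarith [sq_nonneg M]
    · rw [max_eq_left h]; nlinarith
  unfold expectileLoss
  rw [abs_of_nonneg (by have : 0 ≤ 1 - q := by linarith
                        positivity)]
  nlinarith [mul_le_mul_of_nonneg_left h1 (by linarith : 0 ≤ 1 - q),
    mul_le_mul_of_nonneg_left h2 hq0]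

lemma abs_expectileSlope_le {q v p : ℝ} (hq : q ∈ Set.Icc (0 : ℝ) 1) :
    |expectileSlope q v p| ≤ |p - v| := by
  obtain ⟨hq0, hq1⟩ := hq
  unfold expectileSlope
  rcases le_total v p with h | h
  · rw [max_eq_right (by linarith : v - p ≤ 0), max_eq_left (by linarith : 0 ≤ p - v),
      mul_zero, sub_zero, abs_mul, abs_of_nonneg hq0]
    exact mul_le_of_le_one_left (abs_nonneg _) hq1
  · rw [max_eq_right (by linarith : p - v ≤ 0), max_eq_left (by linarith : 0 ≤ v - p),
      mul_zero, zero_sub, abs_neg, abs_mul, abs_of_nonneg (by linarith : 0 ≤ 1 - q),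
      abs_sub_comm p v]
    exact mul_le_of_le_one_left (abs_nonneg _) (by linarith)

/-- On either side of `v` the loss is a quadratic with leading coefficient q or 1-q, both at least
θ. If `v` separates `p` from `p'`, then expanding p' - p through `v` leaves squares and a cross
term, all with nonnegative coefficients. -/
lemma expectileLoss_strongly_convex (q v p p' : ℝ) (hq : q ∈ Set.Icc (0 : ℝ) 1) :
    2 * expectileSlope q v p * (p' - p) + min q (1 - q) * (p' - p) ^ 2 ≤
      expectileLoss q v p' - expectileLoss q v p := by
  obtain ⟨hq0, hq1⟩ := hq
  have h1 : min q (1 - q) ≤ q := min_le_left _ _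
  have h2 : min q (1 - q) ≤ 1 - q := min_le_right _ _
  generalize min q (1 - q) = θ at *
  unfold expectileLoss expectileSlope
  rcases le_total v p with h | h <;> rcases le_total v p' with h' | h'
  · rw [max_eq_right (by linarith : v - p ≤ 0), max_eq_left (by linarith : 0 ≤ p - v),
      max_eq_right (by linarith : v - p' ≤ 0), max_eq_left (by linarith : 0 ≤ p' - v)]
    nlinarith [mul_nonneg (sub_nonneg.2 h1) (sq_nonneg (p' - p))]
  · rw [max_eq_right (by linarith : v - p ≤ 0), max_eq_left (by linarith : 0 ≤ p - v),
      max_eq_left (by linarith : 0 ≤ v - p'), max_eq_right (by linarith : p' - v ≤ 0)]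
    nlinarith [mul_nonneg (sub_nonneg.2 h1) (sq_nonneg (p - v)),
      mul_nonneg (sub_nonneg.2 h2) (sq_nonneg (v - p')),
      mul_nonneg (sub_nonneg.2 h1) (mul_nonneg (sub_nonneg.2 h) (sub_nonneg.2 h'))]
  · rw [max_eq_left (by linarith : 0 ≤ v - p), max_eq_right (by linarith : p - v ≤ 0),
      max_eq_right (by linarith : v - p' ≤ 0), max_eq_left (by linarith : 0 ≤ p' - v)]
    nlinarith [mul_nonneg (sub_nonneg.2 h2) (sq_nonneg (p - v)),
      mul_nonneg (sub_nonneg.2 h1) (sq_nonneg (v - p')),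
      mul_nonneg (sub_nonneg.2 h2) (mul_nonneg (sub_nonneg.2 h) (sub_nonneg.2 h'))]
  · rw [max_eq_left (by linarith : 0 ≤ v - p), max_eq_right (by linarith : p - v ≤ 0),
      max_eq_left (by linarith : 0 ≤ v - p'), max_eq_right (by linarith : p' - v ≤ 0)]
    nlinarith [mul_nonneg (sub_nonneg.2 h2) (sq_nonneg (p' - p))]

lemma expectileSlope_add_le {q v p p' : ℝ} (h : p ≤ p') :
    expectileSlope q v p + min q (1 - q) * (p' - p) ≤ expectileSlope q v p' := by
  have h1 : min q (1 - q) ≤ q := min_le_left _ _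
  have h2 : min q (1 - q) ≤ 1 - q := min_le_right _ _
  generalize min q (1 - q) = θ at *
  unfold expectileSlope
  rcases le_total v p with hv | hv
  · rw [max_eq_right (by linarith : v - p ≤ 0), max_eq_left (by linarith : 0 ≤ p - v),
      max_eq_right (by linarith : v - p' ≤ 0), max_eq_left (by linarith : 0 ≤ p' - v)]
    nlinarith
  · rcases le_total v p' with hv' | hv'
    · rw [max_eq_left (by linarith : 0 ≤ v - p), max_eq_right (by linarith : p - v ≤ 0),
        max_eq_right (by linarith : v - p' ≤ 0), max_eq_left (by linarith : 0 ≤ p' - v)]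
      nlinarith
    · rw [max_eq_left (by linarith : 0 ≤ v - p), max_eq_right (by linarith : p - v ≤ 0),
        max_eq_left (by linarith : 0 ≤ v - p'), max_eq_right (by linarith : p' - v ≤ 0)]
      nlinarith

/-! ### EVaR as the zero of the expected slope. -/

section Measure

variable {q : ℝ} {D : Measure ℝ} [IsProbabilityMeasure D]

lemma abs_sub_le_of_mem_Icc {v p : ℝ} (hv : v ∈ Set.Icc (0 : ℝ) 1) : |p - v| ≤ |p| + 1 :=
  (abs_sub p v).trans (by rw [abs_of_nonneg hv.1]; linarith [hv.2])

lemma integrable_expectileLoss (hq : q ∈ Set.Icc (0 : ℝ) 1)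
    (hD : ∀ᵐ v ∂D, v ∈ Set.Icc (0 : ℝ) 1) (p : ℝ) :
    Integrable (fun v => expectileLoss q v p) D := by
  refine Integrable.of_bound (C := (|p| + 1) ^ 2) ?_ ?_
  · exact ((continuous_expectileLoss q).comp
      (by fun_prop : Continuous fun v : ℝ => (v, p))).aestronglyMeasurable
  · filter_upwards [hD] with v hv using abs_expectileLoss_le hq (abs_sub_le_of_mem_Icc hv)

lemma integrable_expectileSlope (hq : q ∈ Set.Icc (0 : ℝ) 1)
    (hD : ∀ᵐ v ∂D, v ∈ Set.Icc (0 : ℝ) 1) (p : ℝ) :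
    Integrable (fun v => expectileSlope q v p) D := by
  refine Integrable.of_bound (C := |p| + 1) ?_ ?_
  · exact ((continuous_expectileSlope q).comp
      (by fun_prop : Continuous fun v : ℝ => (v, p))).aestronglyMeasurable
  · filter_upwards [hD] with v hv using (abs_expectileSlope_le hq).trans (abs_sub_le_of_mem_Icc hv)

lemma integral_expectileLoss_strongly_convex (hq : q ∈ Set.Icc (0 : ℝ) 1)
    (hD : ∀ᵐ v ∂D, v ∈ Set.Icc (0 : ℝ) 1) (p p' : ℝ) :
    2 * (∫ v, expectileSlope q v p ∂D) * (p' - p) + min q (1 - q) * (p' - p) ^ 2 ≤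
      ∫ v, expectileLoss q v p' ∂D - ∫ v, expectileLoss q v p ∂D := by
  have hs := integrable_expectileSlope hq hD p
  rw [← integral_sub (integrable_expectileLoss hq hD p') (integrable_expectileLoss hq hD p)]
  have : 2 * (∫ v, expectileSlope q v p ∂D) * (p' - p) + min q (1 - q) * (p' - p) ^ 2 =
      ∫ v, (2 * expectileSlope q v p * (p' - p) + min q (1 - q) * (p' - p) ^ 2) ∂D := by
    rw [integral_add ((hs.const_mul 2).mul_const _) (integrable_const _), integral_mul_const,
      integral_const_mul]
    simp
  rw [this]
  exact integral_mono (((hs.const_mul 2).mul_const _).add (integrable_const _))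
    ((integrable_expectileLoss hq hD p').sub (integrable_expectileLoss hq hD p))
    fun v => expectileLoss_strongly_convex q v p p' hq

lemma integral_expectileSlope_strictMono (hq : q ∈ Set.Ioo (0 : ℝ) 1)
    (hD : ∀ᵐ v ∂D, v ∈ Set.Icc (0 : ℝ) 1) :
    StrictMono fun p => ∫ v, expectileSlope q v p ∂D := by
  intro p p' h
  have hq' : q ∈ Set.Icc (0 : ℝ) 1 := Set.Ioo_subset_Icc_self hq
  have hθ : 0 < min q (1 - q) := lt_min hq.1 (by linarith [hq.2])
  have key : ∫ v, (expectileSlope q v p + min q (1 - q) * (p' - p)) ∂D ≤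
      ∫ v, expectileSlope q v p' ∂D :=
    integral_mono ((integrable_expectileSlope hq' hD p).add (integrable_const _))
      (integrable_expectileSlope hq' hD p') fun v => expectileSlope_add_le h.le
  rw [integral_add (integrable_expectileSlope hq' hD p) (integrable_const _)] at key
  simp only [integral_const, probReal_univ, one_smul] at key
  show ∫ v, expectileSlope q v p ∂D < ∫ v, expectileSlope q v p' ∂D
  nlinarith [mul_pos hθ (sub_pos.2 h)]

/-- Since `D` lives on [0,1], the expected slope is nonpositive at 0 and nonnegative at 1, and the
intermediate value theorem applies. -/
lemma exists_integral_expectileSlope_eq_zero (hq : q ∈ Set.Icc (0 : ℝ) 1)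
    (hD : ∀ᵐ v ∂D, v ∈ Set.Icc (0 : ℝ) 1) :
    ∃ p ∈ Set.Icc (0 : ℝ) 1, ∫ v, expectileSlope q v p ∂D = 0 := by
  have hc : ContinuousOn (fun p => ∫ v, expectileSlope q v p ∂D) (Set.Icc (0 : ℝ) 1) := by
    refine continuousOn_of_dominated (bound := fun _ => 2)
      (fun p _ => (integrable_expectileSlope hq hD p).aestronglyMeasurable) ?_
      (integrable_const _) ?_
    · intro p hp
      filter_upwards [hD] with v hv
      refine (abs_expectileSlope_le hq).trans ((abs_sub_le_of_mem_Icc hv).trans ?_)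
      rw [abs_of_nonneg hp.1]; linarith [hp.2]
    · exact .of_forall fun v => ((continuous_expectileSlope q).comp
        (by fun_prop : Continuous fun p : ℝ => (v, p))).continuousOn
  have h0 : ∫ v, expectileSlope q v 0 ∂D ≤ 0 := by
    refine integral_nonpos_of_ae ?_
    filter_upwards [hD] with v hv
    simp only [expectileSlope, zero_sub, sub_zero, Pi.zero_apply]
    rw [max_eq_right (by linarith [hv.1] : -v ≤ 0), max_eq_left hv.1]
    nlinarith [mul_nonneg (sub_nonneg.2 hq.2) hv.1]
  have h1 : 0 ≤ ∫ v, expectileSlope q v 1 ∂D := by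
    refine integral_nonneg_of_ae ?_
    filter_upwards [hD] with v hv
    simp only [expectileSlope, Pi.zero_apply]
    rw [max_eq_right (by linarith [hv.2] : v - 1 ≤ 0), max_eq_left (by linarith [hv.2])]
    nlinarith [mul_nonneg hq.1 (sub_nonneg.2 hv.2)]
  exact intermediate_value_Icc zero_le_one hc ⟨h0, h1⟩

/-- Where the expected slope vanishes, strong convexity leaves an excess of at least θ times the
squared distance, so the minimizer is unique and the `sInf` is taken over a singleton. -/
lemma evar_eq_of_integral_expectileSlope_eq_zero (hq : q ∈ Set.Ioo (0 : ℝ) 1)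
    (hD : ∀ᵐ v ∂D, v ∈ Set.Icc (0 : ℝ) 1) {p : ℝ} (hp : p ∈ Set.Icc (0 : ℝ) 1)
    (h0 : ∫ v, expectileSlope q v p ∂D = 0) : evar q D = p := by
  have hθ : 0 < min q (1 - q) := lt_min hq.1 (by linarith [hq.2])
  have key := integral_expectileLoss_strongly_convex (Set.Ioo_subset_Icc_self hq) hD p
  simp only [h0, mul_zero, zero_mul, zero_add] at key
  have : expectiles q D = {p} := by
    ext r
    simp only [expectiles, Set.mem_ofPred_eq, Set.mem_singleton_iff]
    constructor
    · rintro ⟨-, hmin⟩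
      have h1 := hmin hp
      simp only [Set.mem_ofPred_eq] at h1
      have h2 : (r - p) ^ 2 ≤ 0 := by nlinarith [key r, sq_nonneg (r - p)]
      have h3 : r - p = 0 := pow_eq_zero_iff two_ne_zero |>.1 (le_antisymm h2 (sq_nonneg _))
      linarith
    · rintro rfl
      refine ⟨hp, fun p' _ => ?_⟩
      simp only [Set.mem_ofPred_eq]
      nlinarith [key p', mul_nonneg hθ.le (sq_nonneg (p' - r))]
  rw [evar, this, csInf_singleton]

lemma evar_mem_Icc (hq : q ∈ Set.Ioo (0 : ℝ) 1) (hD : ∀ᵐ v ∂D, v ∈ Set.Icc (0 : ℝ) 1) :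
    evar q D ∈ Set.Icc (0 : ℝ) 1 := by
  obtain ⟨p, hp, h0⟩ := exists_integral_expectileSlope_eq_zero (Set.Ioo_subset_Icc_self hq) hD
  rwa [evar_eq_of_integral_expectileSlope_eq_zero hq hD hp h0]

lemma integral_expectileSlope_evar (hq : q ∈ Set.Ioo (0 : ℝ) 1)
    (hD : ∀ᵐ v ∂D, v ∈ Set.Icc (0 : ℝ) 1) : ∫ v, expectileSlope q v (evar q D) ∂D = 0 := by
  obtain ⟨p, hp, h0⟩ := exists_integral_expectileSlope_eq_zero (Set.Ioo_subset_Icc_self hq) hD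
  rwa [evar_eq_of_integral_expectileSlope_eq_zero hq hD hp h0]

/-- This replaces an argmin by the sign of an integral, which is what makes the risk measurable in
the law. -/
lemma evar_lt_iff (hq : q ∈ Set.Ioo (0 : ℝ) 1) (hD : ∀ᵐ v ∂D, v ∈ Set.Icc (0 : ℝ) 1) (c : ℝ) :
    evar q D < c ↔ 0 < ∫ v, expectileSlope q v c ∂D := by
  rw [← integral_expectileSlope_evar hq hD]
  exact (integral_expectileSlope_strictMono hq hD).lt_iff_lt.symm

lemma mul_sq_sub_evar_le (hq : q ∈ Set.Ioo (0 : ℝ) 1) (hD : ∀ᵐ v ∂D, v ∈ Set.Icc (0 : ℝ) 1)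
    (p : ℝ) : min q (1 - q) * (p - evar q D) ^ 2 ≤
      ∫ v, expectileLoss q v p ∂D - ∫ v, expectileLoss q v (evar q D) ∂D := by
  have key := integral_expectileLoss_strongly_convex (Set.Ioo_subset_Icc_self hq) hD (evar q D) p
  simpa [integral_expectileSlope_evar hq hD] using key

end Measure

/-! ### Inverse gap weighting. -/

section InverseGapWeighting

variable {A : Type*} [Fintype A] {q γ : ℝ} {f : A → I} {ahat : A}

lemma card_le_inverseGap_denom (hθ : 0 ≤ 4 * min q (1 - q) * γ) (hmin : ∀ a, f ahat ≤ f a) (a : A) :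
    (Fintype.card A : ℝ) ≤
      (Fintype.card A : ℝ) + 4 * min q (1 - q) * γ * ((f a : ℝ) - (f ahat : ℝ)) := by
  have : (f ahat : ℝ) ≤ f a := hmin a
  nlinarith [mul_nonneg hθ (sub_nonneg.2 this)]

variable [DecidableEq A]

lemma sum_invGapWeight : ∑ a, invGapWeight q γ f ahat a = 1 := by
  rw [← add_sum_erase univ _ (mem_univ ahat)]
  have : ∑ a ∈ univ.erase ahat, invGapWeight q γ f ahat a = ∑ b ∈ univ.erase ahat,
      1 / ((Fintype.card A : ℝ) + 4 * min q (1 - q) * γ * ((f b : ℝ) - (f ahat : ℝ))) :=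
    sum_congr rfl fun a ha => if_neg (ne_of_mem_erase ha)
  rw [this, invGapWeight, if_pos rfl]
  ring

/-- Each of the n - 1 other actions receives at most 1/n, so at least 1/n remains. -/
lemma inv_card_le_invGapWeight_self (hθ : 0 ≤ 4 * min q (1 - q) * γ)
    (hmin : ∀ a, f ahat ≤ f a) :
    1 / (Fintype.card A : ℝ) ≤ invGapWeight q γ f ahat ahat := by
  have hn : (0 : ℝ) < Fintype.card A := Nat.cast_pos.2 (Fintype.card_pos_iff.2 ⟨ahat⟩)
  rw [invGapWeight, if_pos rfl]
  have h1 : ∑ b ∈ univ.erase ahat,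
      1 / ((Fintype.card A : ℝ) + 4 * min q (1 - q) * γ * ((f b : ℝ) - (f ahat : ℝ))) ≤
      ∑ b ∈ univ.erase ahat, 1 / (Fintype.card A : ℝ) :=
    sum_le_sum fun b _ => one_div_le_one_div_of_le hn (card_le_inverseGap_denom hθ hmin b)
  have h2 : ∑ b : A, 1 / (Fintype.card A : ℝ) = 1 := by
    rw [sum_const, card_univ, nsmul_eq_mul, mul_one_div_cancel hn.ne']
  rw [← add_sum_erase univ _ (mem_univ ahat)] at h2
  linarith

lemma invGapWeight_pos (hθ : 0 ≤ 4 * min q (1 - q) * γ) (hmin : ∀ a, f ahat ≤ f a) (a : A) :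
    0 < invGapWeight q γ f ahat a := by
  have hn : (0 : ℝ) < Fintype.card A := Nat.cast_pos.2 (Fintype.card_pos_iff.2 ⟨ahat⟩)
  by_cases h : a = ahat
  · rw [h]
    exact (one_div_pos.2 hn).trans_le (inv_card_le_invGapWeight_self hθ hmin)
  · rw [invGapWeight, if_neg h]
    exact one_div_pos.2 (hn.trans_le (card_le_inverseGap_denom hθ hmin a))

lemma invGapWeight_le_one (hθ : 0 ≤ 4 * min q (1 - q) * γ) (hmin : ∀ a, f ahat ≤ f a) (a : A) :
    invGapWeight q γ f ahat a ≤ 1 := by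
  rw [← sum_invGapWeight (q := q) (γ := γ) (f := f) (ahat := ahat)]
  exact single_le_sum (f := invGapWeight q γ f ahat)
    (fun b _ => (invGapWeight_pos hθ hmin b).le) (mem_univ a)

/-- The decision-estimation trade-off of inverse gap weighting. -/
lemma sum_invGapWeight_mul_sub_le (hθ : 0 < 4 * min q (1 - q) * γ) (hmin : ∀ a, f ahat ≤ f a)
    (r : A → ℝ) (b : A) :
    ∑ a, invGapWeight q γ f ahat a * (r a - r b) ≤
      2 * Fintype.card A / (4 * min q (1 - q) * γ) + (4 * min q (1 - q) * γ) / 2 *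
        ∑ a, invGapWeight q γ f ahat a * ((f a : ℝ) - r a) ^ 2 := by
  have hn : (0 : ℝ) < Fintype.card A := Nat.cast_pos.2 (Fintype.card_pos_iff.2 ⟨ahat⟩)
  have hpos := invGapWeight_pos hθ.le hmin
  have hsum := sum_invGapWeight (q := q) (γ := γ) (f := f) (ahat := ahat)
  have hself := inv_card_le_invGapWeight_self hθ.le hmin
  have hden := card_le_inverseGap_denom hθ.le hmin
  have hw : ∀ a ≠ ahat, invGapWeight q γ f ahat a =
      1 / ((Fintype.card A : ℝ) + 4 * min q (1 - q) * γ * ((f a : ℝ) - (f ahat : ℝ))) :=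
    fun a h => if_neg h
  generalize 4 * min q (1 - q) * γ = μ at *
  generalize invGapWeight q γ f ahat = w at *
  set n : ℝ := (Fintype.card A : ℝ)
  have hgap : ∀ a, 0 ≤ (f a : ℝ) - f ahat := fun a => sub_nonneg.2 (hmin a)
  have amgm : ∀ x : ℝ, x ≤ μ / 4 * x ^ 2 + 1 / μ := by
    intro x
    have : μ / 4 * x ^ 2 + 1 / μ - x = (μ * x - 2) ^ 2 / (4 * μ) := by field_simp; ring
    have h2 : 0 ≤ (μ * x - 2) ^ 2 / (4 * μ) := by positivity
    linarith
  have e1 : ∑ a, w a * (r a - f a) ≤ μ / 4 * ∑ a, w a * ((f a : ℝ) - r a) ^ 2 + 1 / μ := by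
    calc ∑ a, w a * (r a - f a)
        ≤ ∑ a, (μ / 4 * (w a * ((f a : ℝ) - r a) ^ 2) + w a * (1 / μ)) := by
          refine sum_le_sum fun a _ => ?_
          have := mul_le_mul_of_nonneg_left (amgm (r a - f a)) (hpos a).le
          nlinarith
      _ = _ := by rw [sum_add_distrib, ← mul_sum, ← sum_mul, hsum, one_mul]
  -- The greedy action has no gap. Each other one contributes gap / (n + μ gap) ≤ 1/μ.
  have e2 : ∑ a, w a * ((f a : ℝ) - f ahat) ≤ (n - 1) / μ := by
    rw [← add_sum_erase univ _ (mem_univ ahat), sub_self, mul_zero, zero_add]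
    calc ∑ a ∈ univ.erase ahat, w a * ((f a : ℝ) - f ahat)
        ≤ ∑ a ∈ univ.erase ahat, 1 / μ := by
          refine sum_le_sum fun a ha => ?_
          rw [hw a (ne_of_mem_erase ha), one_div_mul_eq_div,
            div_le_div_iff₀ (hn.trans_le (hden a)) hθ]
          linarith
      _ = (n - 1) / μ := by
          rw [sum_const, card_erase_of_mem (mem_univ _), card_univ, nsmul_eq_mul,
            Nat.cast_pred (Fintype.card_pos_iff.2 ⟨ahat⟩)]
          ring
  -- The inequality `amgm` with μ · w b in place of μ, so that the square carries the weight of the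
  -- comparator.
  have e3 : (f b : ℝ) - r b ≤ μ / 4 * (w b * ((f b : ℝ) - r b) ^ 2) + 1 / (μ * w b) := by
    have hb := hpos b
    have : μ / 4 * (w b * ((f b : ℝ) - r b) ^ 2) + 1 / (μ * w b) - ((f b : ℝ) - r b) =
        (μ * w b * ((f b : ℝ) - r b) - 2) ^ 2 / (4 * (μ * w b)) := by field_simp; ring
    have h2 : 0 ≤ (μ * w b * ((f b : ℝ) - r b) - 2) ^ 2 / (4 * (μ * w b)) := by positivity
    linarith
  -- An equality off the greedy action: the weights are designed so that the price of exploring `b`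
  -- is its predicted gap plus n/μ. The gap cancels when f ahat - r b is written as (f b - r b) - (f
  -- b - f ahat).
  have e4 : 1 / (μ * w b) ≤ n / μ + ((f b : ℝ) - f ahat) := by
    by_cases h : b = ahat
    · subst h
      rw [sub_self, add_zero, div_le_div_iff₀ (mul_pos hθ (hpos b)) hθ]
      rw [div_le_iff₀ hn] at hself
      nlinarith [mul_le_mul_of_nonneg_left hself hθ.le]
    · have hd := hn.trans_le (hden b)
      rw [hw b h]
      apply le_of_eq
      field_simp
  have e5 : w b * ((f b : ℝ) - r b) ^ 2 ≤ ∑ a, w a * ((f a : ℝ) - r a) ^ 2 :=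
    single_le_sum (f := fun a => w a * ((f a : ℝ) - r a) ^ 2)
      (fun a _ => mul_nonneg (hpos a).le (sq_nonneg _)) (mem_univ b)
  have e6 : ∑ a, w a * (r a - r b) = ∑ a, w a * (r a - f a) + ∑ a, w a * ((f a : ℝ) - f ahat) +
      ((f ahat : ℝ) - r b) := by
    rw [← one_mul ((f ahat : ℝ) - r b), ← hsum, sum_mul, ← sum_add_distrib, ← sum_add_distrib]
    exact sum_congr rfl fun a _ => by ring
  have e7 : 2 * n / μ = 1 / μ + (n - 1) / μ + n / μ := by ring
  have e8 := mul_le_mul_of_nonneg_left e5 (by positivity : 0 ≤ μ / 4)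
  rw [e6, e7]
  linarith

end InverseGapWeighting

/-! ### Averaging over the action and the loss function given the past. -/

/-- If, given `X`, the event `S` has probability `w X` and `Y` is independent of it with law `κ X`,
then integrals over `S` of functions of `(X, Y)` can be computed from `w` and `κ`. -/
lemma setIntegral_comp_eq_of_condLaw {Ω Ω' L : Type*} [MeasurableSpace Ω] [MeasurableSpace Ω']
    [MeasurableSpace L] {P : Measure Ω} [IsFiniteMeasure P] {X : Ω → Ω'} (hX : Measurable X)
    {Y : Ω → L} (hY : Measurable Y) {S : Set Ω} {w : Ω' → ℝ}
    (hw : Measurable w) (hw0 : ∀ᵐ ω ∂P, 0 ≤ w (X ω)) {κ : Kernel Ω' L} [IsMarkovKernel κ]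
    (hlaw : ∀ B' : Set Ω', MeasurableSet B' → ∀ B : Set L, MeasurableSet B →
      P (X ⁻¹' B' ∩ (S ∩ Y ⁻¹' B)) =
        ∫⁻ ω in X ⁻¹' B', ENNReal.ofReal (w (X ω)) * κ (X ω) B ∂P)
    {h : Ω' × L → ℝ} (hh : Measurable h) {C : ℝ} (hC : ∀ z, |h z| ≤ C) :
    ∫ ω in S, h (X ω, Y ω) ∂P = ∫ ω, w (X ω) * ∫ l, h (X ω, l) ∂κ (X ω) ∂P := by
  have hXY : Measurable fun ω => (X ω, Y ω) := hX.prodMk hY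
  have hw' : Measurable fun z => ENNReal.ofReal (w z) := hw.ennreal_ofReal
  -- Both measures agree on rectangles, which is the content of `hlaw`.
  have hM : (P.restrict S).map (fun ω => (X ω, Y ω)) =
      ((P.map X).withDensity fun z => ENNReal.ofReal (w z)) ⊗ₘ κ := by
    refine Measure.ext_prod fun {s t} hs ht => ?_
    rw [Measure.map_apply hXY (hs.prod ht), Measure.restrict_apply (hXY (hs.prod ht)),
      Measure.compProd_apply_prod hs ht, restrict_withDensity hs,
      lintegral_withDensity_eq_lintegral_mul _ hw' (κ.measurable_coe ht)]
    rw [setLIntegral_map hs (hw'.mul (κ.measurable_coe ht)) hX]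
    simp only [Pi.mul_apply]
    rw [← hlaw s hs t ht]
    congr 1
    ext ω
    simp only [Set.mem_inter_iff, Set.mem_preimage, Set.mem_prod]
    tauto
  have hint : Integrable h ((P.restrict S).map fun ω => (X ω, Y ω)) :=
    Integrable.of_bound hh.aestronglyMeasurable C (.of_forall hC)
  have hsm : StronglyMeasurable fun z => ∫ l, h (z, l) ∂κ z :=
    hh.stronglyMeasurable.integral_kernel_prod_right'
  rw [← integral_map hXY.aemeasurable hh.aestronglyMeasurable, hM,
    Measure.integral_compProd (hM ▸ hint),
    integral_withDensity_eq_integral_toReal_smul hw' (.of_forall fun _ => ENNReal.ofReal_lt_top),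
    integral_map hX.aemeasurable]
  · refine integral_congr_ae ?_
    filter_upwards [hw0] with ω hω
    rw [ENNReal.toReal_ofReal hω, smul_eq_mul]
  · exact (hw'.ennreal_toReal.stronglyMeasurable.smul hsm).aestronglyMeasurable

variable {A : Type*}

lemma ae_map_eval_mem_Icc (D : Measure (A → I)) (a : A) :
    ∀ᵐ v ∂D.map (fun l : A → I => (l a : ℝ)), v ∈ Set.Icc (0 : ℝ) 1 := by
  have hm : Measurable fun l : A → I => (l a : ℝ) := by fun_prop
  exact (ae_map_iff (p := (· ∈ Set.Icc (0 : ℝ) 1)) hm.aemeasurable measurableSet_Icc).2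
    (.of_forall fun l => (l a).2)

lemma isProbabilityMeasure_map_eval (D : Measure (A → I)) [IsProbabilityMeasure D] (a : A) :
    IsProbabilityMeasure (D.map fun l : A → I => (l a : ℝ)) :=
  Measure.isProbabilityMeasure_map
    (by fun_prop : Measurable fun l : A → I => (l a : ℝ)).aemeasurable

lemma evar_map_eval_mem_Icc {q : ℝ} (hq : q ∈ Set.Ioo (0 : ℝ) 1) (D : Measure (A → I))
    [IsProbabilityMeasure D] (a : A) :
    evar q (D.map fun l : A → I => (l a : ℝ)) ∈ Set.Icc (0 : ℝ) 1 :=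
  have := isProbabilityMeasure_map_eval D a
  evar_mem_Icc hq (ae_map_eval_mem_Icc D a)

lemma measurable_evar_map_eval {Ω : Type*} [MeasurableSpace Ω] {q : ℝ}
    (hq : q ∈ Set.Ioo (0 : ℝ) 1) {κ : Ω → Measure (A → I)} (hκ : Measurable κ)
    (hp : ∀ ω, IsProbabilityMeasure (κ ω)) (a : A) :
    Measurable fun ω => evar q ((κ ω).map fun l : A → I => (l a : ℝ)) := by
  refine measurable_of_Iio fun c => ?_
  have hs : Continuous fun v => expectileSlope q v c :=
    (continuous_expectileSlope q).comp (by fun_prop : Continuous fun v : ℝ => (v, c))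
  have hm : Measurable fun l : A → I => (l a : ℝ) := by fun_prop
  have hset : (fun ω => evar q ((κ ω).map fun l : A → I => (l a : ℝ))) ⁻¹' Set.Iio c =
      {ω | 0 < ∫ l, expectileSlope q (l a) c ∂κ ω} := by
    ext ω
    have := hp ω
    have := isProbabilityMeasure_map_eval (κ ω) a
    rw [Set.mem_preimage, Set.mem_Iio, evar_lt_iff hq (ae_map_eval_mem_Icc _ a),
      integral_map hm.aemeasurable hs.aestronglyMeasurable, Set.mem_ofPred_eq]
  rw [hset]
  have : StronglyMeasurable fun ω =>
      ∫ l, expectileSlope q (l a) c ∂(⟨κ, hκ⟩ : Kernel Ω (A → I)) ω :=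
    (hs.measurable.comp hm).stronglyMeasurable.integral_kernel
  exact measurableSet_lt measurable_const this.measurable

/-- Here `X` is the past and `S` the event that `a` is played. Prediction and risk are functions of
`X`, so the realized loss may be averaged over its law κ(X), and `mul_sq_sub_evar_le` applies for
each value of `X`. -/
lemma mul_integral_sq_le_setIntegral_expectileLoss_sub {Ω Ω' : Type*} {mΩ : MeasurableSpace Ω}
    {mΩ' : MeasurableSpace Ω'} {P : Measure Ω} [IsFiniteMeasure P] {X : Ω → Ω'} (hX : Measurable X)
    {Y : Ω → A → I} (hY : Measurable Y) {S : Set Ω} {w : Ω' → ℝ}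
    (hw : Measurable w) (hw01 : ∀ᵐ ω ∂P, w (X ω) ∈ Set.Icc (0 : ℝ) 1) {κ : Ω' → Measure (A → I)}
    (hκ : Measurable κ) (hp : ∀ ω, IsProbabilityMeasure (κ ω))
    (hlaw : ∀ B' : Set Ω', MeasurableSet B' → ∀ B : Set (A → I), MeasurableSet B →
      P (X ⁻¹' B' ∩ (S ∩ Y ⁻¹' B)) =
        ∫⁻ ω in X ⁻¹' B', ENNReal.ofReal (w (X ω)) * κ (X ω) B ∂P)
    {q : ℝ} (hq : q ∈ Set.Ioo (0 : ℝ) 1) {f : Ω' → I} (hf : Measurable f) (a : A) :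
    min q (1 - q) * ∫ ω, w (X ω) *
        ((f (X ω) : ℝ) - evar q ((κ (X ω)).map fun l : A → I => (l a : ℝ))) ^ 2 ∂P ≤
      ∫ ω in S, (expectileLoss q (Y ω a) (f (X ω)) -
        expectileLoss q (Y ω a) (evar q ((κ (X ω)).map fun l : A → I => (l a : ℝ)))) ∂P := by
  have hq' : q ∈ Set.Icc (0 : ℝ) 1 := Set.Ioo_subset_Icc_self hq
  set r : Ω' → ℝ := fun z => evar q ((κ z).map fun l : A → I => (l a : ℝ)) with hr
  have hrm : Measurable r := measurable_evar_map_eval hq hκ hp a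
  have hr01 : ∀ z, r z ∈ Set.Icc (0 : ℝ) 1 := fun z => evar_map_eval_mem_Icc hq (κ z) a
  have hloss := (continuous_expectileLoss q).measurable
  let h : Ω' × (A → I) → ℝ := fun z =>
    expectileLoss q (z.2 a) (f z.1) - expectileLoss q (z.2 a) (r z.1)
  have hl1 : ∀ z : Ω' × (A → I), expectileLoss q (z.2 a) (f z.1) ∈ Set.Icc (0 : ℝ) 1 :=
    fun z => expectileLoss_mem_Icc hq' (z.2 a).2 (f z.1).2
  have hl2 : ∀ z : Ω' × (A → I), expectileLoss q (z.2 a) (r z.1) ∈ Set.Icc (0 : ℝ) 1 :=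
    fun z => expectileLoss_mem_Icc hq' (z.2 a).2 (hr01 z.1)
  have hm : Measurable fun l : A → I => (l a : ℝ) := by fun_prop
  have hma : Measurable fun z : Ω' × (A → I) => (z.2 a : ℝ) := hm.comp measurable_snd
  have hh : Measurable h :=
    (hloss.comp (hma.prodMk (hf.comp measurable_fst).subtype_val)).sub
      (hloss.comp (hma.prodMk (hrm.comp measurable_fst)))
  have hC : ∀ z, |h z| ≤ 1 := fun z => by
    have := hl1 z; have := hl2 z
    simp only [Set.mem_Icc] at *
    rw [abs_le]; constructor <;> simp only [h] <;> linarith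
  let K : Kernel Ω' (A → I) := ⟨κ, hκ⟩
  have : IsMarkovKernel K := ⟨hp⟩
  have key := setIntegral_comp_eq_of_condLaw (κ := K) hX hY hw
    (hw01.mono fun ω hω => hω.1) hlaw hh hC
  show _ ≤ ∫ ω in S, h (X ω, Y ω) ∂P
  rw [key, ← integral_const_mul]
  have hpt : ∀ z, min q (1 - q) * ((f z : ℝ) - r z) ^ 2 ≤ ∫ l, h (z, l) ∂K z := by
    intro z
    have := hp z
    have := isProbabilityMeasure_map_eval (κ z) a
    have hc : ∀ c : ℝ, Continuous fun v => expectileLoss q v c := fun c =>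
      (continuous_expectileLoss q).comp (by fun_prop : Continuous fun v : ℝ => (v, c))
    have h1 := mul_sq_sub_evar_le hq (ae_map_eval_mem_Icc (κ z) a) (f z)
    rw [integral_map hm.aemeasurable (hc _).aestronglyMeasurable,
      integral_map hm.aemeasurable (hc _).aestronglyMeasurable, ← integral_sub] at h1
    · exact h1
    · exact Integrable.of_bound ((hc _).measurable.comp hm).aestronglyMeasurable 1
        (.of_forall fun l => by
          rw [Real.norm_eq_abs, abs_of_nonneg (hl1 (z, l)).1]; exact (hl1 (z, l)).2)
    · exact Integrable.of_bound ((hc _).measurable.comp hm).aestronglyMeasurable 1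
        (.of_forall fun l => by
          rw [Real.norm_eq_abs, abs_of_nonneg (hl2 (z, l)).1]; exact (hl2 (z, l)).2)
  have hKm : Measurable fun z => ∫ l, h (z, l) ∂K z :=
    hh.stronglyMeasurable.integral_kernel_prod_right'.measurable
  have hKb : ∀ z, |∫ l, h (z, l) ∂K z| ≤ 1 := fun z => by
    simpa using norm_integral_le_of_norm_le_const (μ := K z) (f := fun l => h (z, l)) (C := 1)
      (.of_forall fun l => hC (z, l))
  refine integral_mono_ae ?_ ?_ ?_
  · refine Integrable.of_bound (C := 1) ?_ ?_
    · exact (measurable_const.mul ((hw.comp hX).mul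
        (((hf.comp hX).subtype_val.sub (hrm.comp hX)).pow_const 2))).aestronglyMeasurable
    · filter_upwards [hw01] with ω hω
      have h1 := hpt (X ω)
      have h2 := (abs_le.1 (hKb (X ω))).2
      have h3 : 0 ≤ min q (1 - q) * ((f (X ω) : ℝ) - r (X ω)) ^ 2 :=
        mul_nonneg (le_min hq'.1 (by linarith [hq'.2])) (sq_nonneg _)
      rw [mul_left_comm, Real.norm_eq_abs, abs_of_nonneg (mul_nonneg hω.1 h3)]
      exact mul_le_one₀ hω.2 h3 (h1.trans h2)
  · refine Integrable.of_bound (C := 1)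
      ((hw.comp hX).mul (hKm.comp hX)).aestronglyMeasurable ?_
    filter_upwards [hw01] with ω hω
    rw [norm_mul, Real.norm_eq_abs, Real.norm_eq_abs, abs_of_nonneg hω.1]
    exact mul_le_one₀ hω.2 (abs_nonneg _) (hKb _)
  · filter_upwards [hw01] with ω hω
    rw [mul_left_comm]
    exact mul_le_mul_of_nonneg_left (hpt _) hω.1

/-! ### Measurability of the action weights. -/

section Measurability

variable [Fintype A] [MeasurableSpace A] [MeasurableSingletonClass A]

lemma measurable_eval_prod : Measurable fun z : (A → I) × A => z.1 z.2 :=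
  measurable_from_prod_countable_left fun a => measurable_pi_apply a

lemma measurable_invGapWeight [DecidableEq A] (q γ : ℝ) (a : A) :
    Measurable fun z : (A → I) × A => invGapWeight q γ z.1 z.2 a := by
  refine measurable_from_prod_countable_left fun ahat => ?_
  by_cases h : a = ahat
  · simp only [invGapWeight, if_pos h]
    fun_prop
  · simp only [invGapWeight, if_neg h]
    fun_prop

end Measurability

/-! ### Regret of an interaction that follows the protocol. -/

namespace Interaction

variable [Fintype A] [DecidableEq A] [MeasurableSpace A] {X Ω : Type*}
  [MeasurableSpace X] [mΩ : MeasurableSpace Ω] {E : Interaction X A Ω}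
  {P : Measure Ω} {oracle : RegOracle X A} {q γ : ℝ} {T t : ℕ}

namespace FollowsProtocol

lemma measurable_pred [MeasurableSingletonClass A] (hE : E.FollowsProtocol P oracle q γ T)
    (ho : oracle.IsMeasurable) (ht : t < T) (a : A) :
    Measurable[E.known t] fun ω => E.pred oracle t ω a := by
  have hex : Measurable[E.known t] fun ω => examples (fun s => E.ctx s ω) (fun s => E.act s ω)
      (fun s => E.loss s ω (E.act s ω)) t := by
    refine @measurable_pi_lambda _ _ _ (E.known t) _ _ fun s => ?_
    have hs : (s : ℕ) < T := s.2.trans ht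
    have h1 := (hE.measurable_ctx s hs).mono (E.known.mono s.2.le) le_rfl
    -- Action and loss of round s are known only from time s + 1, and s < t means s + 1 ≤ t.
    have h2 := (hE.measurable_act s hs).mono (E.known.mono s.2) le_rfl
    have h3 := (hE.measurable_loss s hs).mono (E.known.mono s.2) le_rfl
    exact h1.prodMk (h2.prodMk (measurable_eval_prod.comp (h3.prodMk h2)))
  exact (ho t a).comp (hex.prodMk (hE.measurable_ctx t ht))

lemma measurable_prob [MeasurableSingletonClass A] (hE : E.FollowsProtocol P oracle q γ T)
    (ho : oracle.IsMeasurable) (ht : t < T) (a : A) :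
    Measurable[E.known t] fun ω => E.prob oracle q γ t ω a :=
  (measurable_invGapWeight q γ a).comp
    ((@measurable_pi_lambda _ _ _ (E.known t) _ _ fun b => hE.measurable_pred ho ht b).prodMk
      (hE.measurable_greedy t ht))

lemma measurable_risk (hE : E.FollowsProtocol P oracle q γ T) (hq : q ∈ Set.Ioo (0 : ℝ) 1)
    (ht : t < T) (a : A) : Measurable[E.known t] fun ω => E.risk q t ω a :=
  @measurable_evar_map_eval _ _ (E.known t) q hq _ (hE.measurable_lossLaw t ht)
    (hE.isProbabilityMeasure_lossLaw t ht) a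

lemma risk_mem_Icc (hE : E.FollowsProtocol P oracle q γ T) (hq : q ∈ Set.Ioo (0 : ℝ) 1)
    (ht : t < T) (ω : Ω) (a : A) : E.risk q t ω a ∈ Set.Icc (0 : ℝ) 1 :=
  have := hE.isProbabilityMeasure_lossLaw t ht ω
  evar_map_eval_mem_Icc hq _ a

lemma prob_mem_Icc (hE : E.FollowsProtocol P oracle q γ T)
    (hθ : 0 ≤ 4 * min q (1 - q) * γ) (ht : t < T) :
    ∀ᵐ ω ∂P, ∀ a, E.prob oracle q γ t ω a ∈ Set.Icc (0 : ℝ) 1 := by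
  filter_upwards [hE.greedy_le t ht] with ω hω a
  exact ⟨(invGapWeight_pos hθ hω a).le, invGapWeight_le_one hθ hω a⟩

lemma measurable_regCB [MeasurableSingletonClass A] (hE : E.FollowsProtocol P oracle q γ T)
    (ho : oracle.IsMeasurable) (hq : q ∈ Set.Ioo (0 : ℝ) 1) :
    Measurable (E.regCB oracle q γ T) := by
  refine Finset.measurable_fun_sum _ fun t ht => Finset.measurable_fun_sum _ fun a _ => ?_
  have ht' : t < T := mem_range.1 ht
  have hr := fun b => (hE.measurable_risk hq ht' b).mono (E.known.le t) le_rfl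
  exact ((hE.measurable_prob ho ht' a).mono (E.known.le t) le_rfl).mul
    ((hr a).sub (Measurable.iInf hr))

lemma integrable_regCB [MeasurableSingletonClass A] [Nonempty A] [IsFiniteMeasure P]
    (hE : E.FollowsProtocol P oracle q γ T) (ho : oracle.IsMeasurable)
    (hq : q ∈ Set.Ioo (0 : ℝ) 1) (hθ : 0 ≤ 4 * min q (1 - q) * γ) :
    Integrable (E.regCB oracle q γ T) P := by
  refine Integrable.of_bound (C := ∑ t ∈ range T, ∑ _a : A, (1 : ℝ))
    (hE.measurable_regCB ho hq).aestronglyMeasurable ?_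
  have hall : ∀ᵐ ω ∂P, ∀ t < T, ∀ a, E.prob oracle q γ t ω a ∈ Set.Icc (0 : ℝ) 1 := by
    rw [ae_all_iff]; intro t
    by_cases ht : t < T
    · filter_upwards [hE.prob_mem_Icc hθ ht] with ω hω _ using hω
    · exact .of_forall fun ω h => absurd h ht
  filter_upwards [hall] with ω hω
  refine (norm_sum_le _ _).trans (sum_le_sum fun t ht => (norm_sum_le _ _).trans
    (sum_le_sum fun a _ => ?_))
  have ht' := mem_range.1 ht
  obtain ⟨b, hb⟩ := exists_eq_ciInf_of_finite (f := fun b => E.risk q t ω b)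
  have h1 := hω t ht' a
  have h2 := hE.risk_mem_Icc hq ht' ω a
  have h3 := hE.risk_mem_Icc hq ht' ω b
  rw [← hb, norm_mul, Real.norm_eq_abs, Real.norm_eq_abs, abs_of_nonneg h1.1]
  refine mul_le_one₀ h1.2 (abs_nonneg _) (abs_le.2 ?_)
  constructor <;> linarith [h2.1, h2.2, h3.1, h3.2]

lemma integrable_sq_error [MeasurableSingletonClass A] [IsFiniteMeasure P]
    (hE : E.FollowsProtocol P oracle q γ T) (ho : oracle.IsMeasurable)
    (hq : q ∈ Set.Ioo (0 : ℝ) 1) (hθ : 0 ≤ 4 * min q (1 - q) * γ) (ht : t < T) (a : A) :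
    Integrable (fun ω => E.prob oracle q γ t ω a *
      ((E.pred oracle t ω a : ℝ) - E.risk q t ω a) ^ 2) P := by
  refine Integrable.of_bound (C := 1) ?_ ?_
  · have h1 := (hE.measurable_prob ho ht a).mono (E.known.le t) le_rfl
    have h2 := (hE.measurable_pred ho ht a).mono (E.known.le t) le_rfl
    have h3 := (hE.measurable_risk hq ht a).mono (E.known.le t) le_rfl
    exact (h1.mul ((h2.subtype_val.sub h3).pow_const 2)).aestronglyMeasurable
  · filter_upwards [hE.prob_mem_Icc hθ ht] with ω hω
    have h1 := hω a
    have h2 := hE.risk_mem_Icc hq ht ω a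
    have h3 := (E.pred oracle t ω a).2
    rw [norm_mul, Real.norm_eq_abs, Real.norm_eq_abs, abs_of_nonneg h1.1, abs_sq]
    refine mul_le_one₀ h1.2 (sq_nonneg _) ?_
    exact (sq_le_one_iff_abs_le_one _).2 (abs_le.2 (by
      constructor <;> linarith [h2.1, h2.2, h3.1, h3.2]))

lemma integrable_excess_loss [MeasurableSingletonClass A] [IsFiniteMeasure P]
    (hE : E.FollowsProtocol P oracle q γ T) (ho : oracle.IsMeasurable)
    (hq : q ∈ Set.Ioo (0 : ℝ) 1) (ht : t < T) (a : A) :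
    Integrable (fun ω => expectileLoss q (E.loss t ω a) (E.pred oracle t ω a) -
      expectileLoss q (E.loss t ω a) (E.risk q t ω a)) P := by
  have hq' : q ∈ Set.Icc (0 : ℝ) 1 := Set.Ioo_subset_Icc_self hq
  have h2 := (hE.measurable_pred ho ht a).mono (E.known.le t) le_rfl
  have h3 := (hE.measurable_risk hq ht a).mono (E.known.le t) le_rfl
  have h4 := (measurable_pi_apply a).comp ((hE.measurable_loss t ht).mono (E.known.le _) le_rfl)
  have hl := (continuous_expectileLoss q).measurable
  refine Integrable.of_bound (C := 1) ((hl.comp (h4.subtype_val.prodMk h2.subtype_val)).sub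
    (hl.comp (h4.subtype_val.prodMk h3))).aestronglyMeasurable (.of_forall fun ω => abs_le.2 ?_)
  have h5 := expectileLoss_mem_Icc hq' (E.loss t ω a).2 (E.pred oracle t ω a).2
  have h6 := expectileLoss_mem_Icc hq' (E.loss t ω a).2 (hE.risk_mem_Icc hq ht ω a)
  constructor <;> linarith [h5.1, h5.2, h6.1, h6.2]

lemma measurableSet_act_eq [MeasurableSingletonClass A] (hE : E.FollowsProtocol P oracle q γ T)
    (ht : t < T) (a : A) : MeasurableSet {ω | E.act t ω = a} :=
  ((hE.measurable_act t ht).mono (E.known.le _) le_rfl) (measurableSet_singleton a)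

lemma mul_integral_sq_error_le [MeasurableSingletonClass A] [IsFiniteMeasure P]
    (hE : E.FollowsProtocol P oracle q γ T) (ho : oracle.IsMeasurable)
    (hq : q ∈ Set.Ioo (0 : ℝ) 1) (hθ : 0 ≤ 4 * min q (1 - q) * γ) (ht : t < T) (a : A) :
    min q (1 - q) * ∫ ω, E.prob oracle q γ t ω a *
        ((E.pred oracle t ω a : ℝ) - E.risk q t ω a) ^ 2 ∂P ≤
      ∫ ω in {ω | E.act t ω = a}, (expectileLoss q (E.loss t ω a) (E.pred oracle t ω a) -
        expectileLoss q (E.loss t ω a) (E.risk q t ω a)) ∂P :=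
  -- The past is encoded by the identity, with the σ-algebra `E.known t` on its target; preimages
  -- are then exactly the events known in round t.
  mul_integral_sq_le_setIntegral_expectileLoss_sub (Ω' := Ω) (X := id)
    (mΩ' := E.known t)
    (measurable_id'' (E.known.le t)) ((hE.measurable_loss t ht).mono (E.known.le _) le_rfl)
    (hE.measurable_prob ho ht a) ((hE.prob_mem_Icc hθ ht).mono fun _ h => h a)
    (hE.measurable_lossLaw t ht) (hE.isProbabilityMeasure_lossLaw t ht)
    (fun B' hB' B hB => hE.law_act_loss t ht B' hB' a B hB) hq (hE.measurable_pred ho ht a) a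

/-- The oracle's regret bounds the expected squared estimation error. -/
lemma mul_sum_integral_sq_error_le [MeasurableSingletonClass A] [IsProbabilityMeasure P]
    (hE : E.FollowsProtocol P oracle q γ T) (ho : oracle.IsMeasurable)
    (hq : q ∈ Set.Ioo (0 : ℝ) 1) (hθ : 0 ≤ 4 * min q (1 - q) * γ) {F : Set (X → A → I)} {R : ℝ}
    (hR : oracle.HasRegret q F T R) (hF : E.Realizable P q F T) :
    min q (1 - q) * ∑ t ∈ range T, ∑ a, ∫ ω, E.prob oracle q γ t ω a *
        ((E.pred oracle t ω a : ℝ) - E.risk q t ω a) ^ 2 ∂P ≤ R := by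
  let G : ℕ → A → Ω → ℝ := fun t a => {ω | E.act t ω = a}.indicator fun ω =>
    expectileLoss q (E.loss t ω a) (E.pred oracle t ω a) -
      expectileLoss q (E.loss t ω a) (E.risk q t ω a)
  have hG : ∀ t ∈ range T, ∀ a, Integrable (G t a) P := fun t ht a =>
    (hE.integrable_excess_loss ho hq (mem_range.1 ht) a).indicator
      (hE.measurableSet_act_eq (mem_range.1 ht) a)
  calc min q (1 - q) * ∑ t ∈ range T, ∑ a, ∫ ω, E.prob oracle q γ t ω a *
        ((E.pred oracle t ω a : ℝ) - E.risk q t ω a) ^ 2 ∂P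
      ≤ ∑ t ∈ range T, ∑ a, ∫ ω, G t a ω ∂P := by
        rw [mul_sum]
        refine sum_le_sum fun t ht => ?_
        rw [mul_sum]
        refine sum_le_sum fun a _ => ?_
        rw [integral_indicator (hE.measurableSet_act_eq (mem_range.1 ht) a)]
        exact hE.mul_integral_sq_error_le ho hq hθ (mem_range.1 ht) a
    _ = ∫ ω, ∑ t ∈ range T, ∑ a, G t a ω ∂P := by
        rw [integral_finsetSum _ fun t ht => integrable_finsetSum _ fun a _ => hG t ht a]
        exact sum_congr rfl fun t ht => (integral_finsetSum _ fun a _ => hG t ht a).symm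
    _ ≤ ∫ _ω, R ∂P := by
        refine integral_mono_ae (integrable_finsetSum _ fun t ht =>
          integrable_finsetSum _ fun a _ => hG t ht a) (integrable_const _) ?_
        -- The realizing `f` may vary with ω, which is harmless because the regret bound holds for
        -- every `f` on every single trajectory.
        filter_upwards [hF] with ω ⟨f, hf, hfr⟩
        refine le_trans (le_of_eq (sum_congr rfl fun t ht => ?_)) (hR (fun s => E.ctx s ω)
          (fun s => E.act s ω) (fun s => E.loss s ω (E.act s ω)) f hf)
        rw [hfr t (mem_range.1 ht), sum_eq_single (E.act t ω)]
        · exact Set.indicator_of_mem (s := {ω' | E.act t ω' = E.act t ω}) rfl _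
        · exact fun a _ ha =>
            Set.indicator_of_notMem (s := {ω' | E.act t ω' = a}) (fun h => ha h.symm) _
        · exact fun h => absurd (mem_univ _) h
    _ = R := by simp

lemma integral_regCB_le [MeasurableSingletonClass A] [Nonempty A] [IsProbabilityMeasure P]
    (hE : E.FollowsProtocol P oracle q γ T) (ho : oracle.IsMeasurable)
    (hq : q ∈ Set.Ioo (0 : ℝ) 1) (hγ : 0 < γ) {F : Set (X → A → I)} {R : ℝ}
    (hR : oracle.HasRegret q F T R) (hF : E.Realizable P q F T) :
    ∫ ω, E.regCB oracle q γ T ω ∂P ≤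
      Fintype.card A * T / (2 * min q (1 - q) * γ) + 2 * γ * R := by
  have hθ0 : 0 < min q (1 - q) := lt_min hq.1 (by linarith [hq.2])
  have hθ : 0 < 4 * min q (1 - q) * γ := by positivity
  have hint := fun t (ht : t ∈ range T) a =>
    hE.integrable_sq_error ho hq hθ.le (mem_range.1 ht) a
  have hint' := integrable_finsetSum (range T) fun t ht =>
    integrable_finsetSum univ fun a _ => hint t ht a
  have hall : ∀ᵐ ω ∂P, ∀ t < T, ∀ a, E.pred oracle t ω (E.greedy t ω) ≤ E.pred oracle t ω a := by
    rw [ae_all_iff]; intro t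
    by_cases ht : t < T
    · filter_upwards [hE.greedy_le t ht] with ω hω _ using hω
    · exact .of_forall fun ω h => absurd h ht
  have hmono : ∫ ω, E.regCB oracle q γ T ω ∂P ≤
      ∫ ω, (T * (2 * Fintype.card A / (4 * min q (1 - q) * γ)) + (4 * min q (1 - q) * γ) / 2 *
        ∑ t ∈ range T, ∑ a, E.prob oracle q γ t ω a *
          ((E.pred oracle t ω a : ℝ) - E.risk q t ω a) ^ 2) ∂P := by
    refine integral_mono_ae (hE.integrable_regCB ho hq hθ.le)
      ((integrable_const _).add (hint'.const_mul _)) ?_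
    filter_upwards [hall] with ω hω
    calc E.regCB oracle q γ T ω
        ≤ ∑ t ∈ range T, (2 * Fintype.card A / (4 * min q (1 - q) * γ) +
            (4 * min q (1 - q) * γ) / 2 * ∑ a, E.prob oracle q γ t ω a *
              ((E.pred oracle t ω a : ℝ) - E.risk q t ω a) ^ 2) := by
          refine sum_le_sum fun t ht => ?_
          -- The trade-off holds against any comparator, in particular a minimizer of the true risk
          -- in this round.
          obtain ⟨b, hb⟩ := exists_eq_ciInf_of_finite (f := fun b => E.risk q t ω b)
          rw [← hb]
          exact sum_invGapWeight_mul_sub_le hθ (hω t (mem_range.1 ht)) (E.risk q t ω) b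
      _ = _ := by
          rw [sum_add_distrib, ← mul_sum, sum_const, card_range, nsmul_eq_mul]
  refine hmono.trans ?_
  rw [integral_add (integrable_const _) (hint'.const_mul _), integral_const, probReal_univ,
    one_smul, integral_const_mul, integral_finsetSum _ fun t ht =>
      integrable_finsetSum _ fun a _ => hint t ht a]
  rw [sum_congr rfl fun t ht => integral_finsetSum _ fun a _ => hint t ht a]
  have key := hE.mul_sum_integral_sq_error_le ho hq hθ.le hR hF
  have key' := mul_le_mul_of_nonneg_left key (by positivity : 0 ≤ 2 * γ)
  have e : (T : ℝ) * (2 * Fintype.card A / (4 * min q (1 - q) * γ)) =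
      Fintype.card A * T / (2 * min q (1 - q) * γ) := by field_simp; ring
  rw [e]
  refine add_le_add le_rfl (le_trans (le_of_eq ?_) key')
  ring

end FollowsProtocol

end Interaction

end ExpectileBandit

/-! ### Choice of the learning rate. -/

theorem theorem1 :
    ∃ C : ℝ, 0 < C ∧
      ∀ (n T : ℕ) (q R : ℝ), 0 < q → q < 1 → 0 < R →
        ∃ γ : ℝ, 0 < γ ∧
          ∀ (A : Type*) [Fintype A] [DecidableEq A] [Nonempty A] [MeasurableSpace A]
            [MeasurableSingletonClass A] (X : Type*) [MeasurableSpace X]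
            (F : Set (X → A → I)) (oracle : RegOracle X A)
            (Ω : Type*) [MeasurableSpace Ω] (P : Measure Ω) [IsProbabilityMeasure P]
            (E : Interaction X A Ω),
            Fintype.card A = n →
            oracle.IsMeasurable →
            oracle.HasRegret q F T R →
            E.FollowsProtocol P oracle q γ T →
            E.Realizable P q F T →
              Integrable (E.regCB oracle q γ T) P ∧
              ∫ ω, E.regCB oracle q γ T ω ∂P ≤
                C * (1 / min q (1 - q) * √((n : ℝ) * T * R)) := by
  refine ⟨2, two_pos, fun n T q R hq0 hq1 hR => ?_⟩
  have hq : q ∈ Set.Ioo (0 : ℝ) 1 := ⟨hq0, hq1⟩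
  have hθ : 0 < min q (1 - q) := lt_min hq0 (by linarith)
  have hθ1 : min q (1 - q) ≤ 1 / 2 := by
    rcases le_total q (1 - q) with h | h
    · rw [min_eq_left h]; linarith
    · rw [min_eq_right h]; linarith
  -- If nT = 0 the balancing rate would be 0, which is not allowed. Since there is an action, T = 0
  -- and the regret is an empty sum, so any γ works.
  rcases Nat.eq_zero_or_pos (n * T) with hnT | hnT
  · refine ⟨1, one_pos, ?_⟩
    intro A _ _ _ _ _ X _ F oracle Ω _ P _ E hA ho hreg hE hF
    have hT : T = 0 := (Nat.mul_eq_zero.1 hnT).resolve_left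
      (hA ▸ Fintype.card_ne_zero)
    refine ⟨hE.integrable_regCB ho hq (by positivity), ?_⟩
    subst hT
    simp [Interaction.regCB]
  · have hN : (0 : ℝ) < n * T := by exact_mod_cast hnT
    have hs : 0 < √((n : ℝ) * T * R) := Real.sqrt_pos.2 (by positivity)
    -- With s = √(nTR) and γ = s/R the two terms become s/(2θ) and 2s. As θ ≤ 1/2, the latter is at
    -- most s/θ, so the total is at most (3/2) s/θ, within the constant 2.
    refine ⟨√((n : ℝ) * T * R) / R, by positivity, ?_⟩
    intro A _ _ _ _ _ X _ F oracle Ω _ P _ E hA ho hreg hE hF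
    refine ⟨hE.integrable_regCB ho hq (by positivity), ?_⟩
    refine (hE.integral_regCB_le ho hq (by positivity) hreg hF).trans ?_
    rw [hA]
    have hsq : √((n : ℝ) * T * R) ^ 2 = n * T * R := Real.sq_sqrt (by positivity)
    generalize √((n : ℝ) * T * R) = s at *
    generalize min q (1 - q) = θ at *
    have e1 : (n : ℝ) * T / (2 * θ * (s / R)) = 1 / 2 * (1 / θ * s) := by
      have : (n : ℝ) * T = s ^ 2 / R := by rw [hsq]; field_simp
      rw [this]; field_simp
    have e2 : 2 * (s / R) * R = 2 * s := by field_simp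
    have e3 : 2 * s ≤ 1 / θ * s :=
      mul_le_mul_of_nonneg_right (by rw [le_div_iff₀ hθ]; linarith) hs.le
    have e4 : 0 ≤ 1 / θ * s := by positivity
    rw [e1, e2]
    linarith
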